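/- Let $H$ be a Hilbert space over $\mathbb F\in\{\mathbb R,\mathbb C\}$ and let $\mathcal L$ be a commutative subspace lattice on $H$, that is, a collection of closed subspaces of $H$ which contains $\{0\}$ and $H$, is closed under arbitrary intersections and arbitrary closed linear spans, and is such that the orthogonal projections onto the members of $\mathcal L$ commute with each other. Assume that $\mathcal L\neq\{\{0\},H\}$. Let $\mathrm{Alg}\,\mathcal L$ be the algebra (with the operator norm) of all bounded linear operators $T$ on $H$ with $T(M)\subseteq M$ for all $M\in\mathcal L$. Let $L\in\mathcal L$ with $L\neq\{0\}$ and $L\neq H$, and let $P_L$ be the orthogonal projection onto $L$; it belongs to $\mathrm{Alg}\,\mathcal L$. Let $\delta:\mathrm{Alg}\,\mathcal L\to\mathrm{Alg}\,\mathcal L$ be a continuous linear map. Then $\delta$ satisfies $$A,B\in\mathrm{Alg}\,\mathcal L,\quad AB+BA=P_L\ \Longrightarrow\ 2A\delta(B)+2B\delta(A)=\delta(P_L)$$ if and only if there is a continuous linear map $\beta:\mathrm{Alg}\,\mathcal L\to\mathrm{Alg}\,\mathcal L$ such that $$\delta(A)=\beta(A)+P_LA(I-P_L)\delta(I)\quad\text{for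 all }A\in\mathrm{Alg}\,\mathcal L$$ and the following three conditions hold: 1. $\beta(A)=(I-P_L)\,\beta\big((I-P_L)A(I-P_L)\big)\,(I-P_L)$ for all $A\in\mathrm{Alg}\,\mathcal L$; 2. for all $A,B\in\mathrm{Alg}\,\mathcal L$, if $(I-P_L)A(I-P_L)B(I-P_L)+(I-P_L)B(I-P_L)A(I-P_L)=0$, then $(I-P_L)A\beta(B)+(I-P_L)B\beta(A)=0$; 3. $P_LA(I-P_L)\beta(B)=P_LA(I-P_L)B(I-P_L)\delta(I)$ for all $A,B\in\mathrm{Alg}\,\mathcal L$. -/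

import Mathlib

/-- A subspace lattice on a Hilbert space `H`: a collection of closed subspaces that is closed under
arbitrary intersections and arbitrary closed linear spans. It contains `{0}` (the empty span) and
`H` (the empty intersection). -/
abbrev SubspaceLattice (𝕜 H : Type*) [RCLike 𝕜] [NormedAddCommGroup H] [InnerProductSpace 𝕜 H] :=
  CompleteSublattice (ClosedSubmodule 𝕜 H)

namespace SubspaceLattice

variable {𝕜 H : Type*} [RCLike 𝕜] [NormedAddCommGroup H] [InnerProductSpace 𝕜 H]

/-- `Alg 𝓛`: the algebra of all bounded operators on `H` that leave every member of `𝓛` invariant.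
It carries the operator norm. -/
def Alg (𝓛 : SubspaceLattice 𝕜 H) : Subalgebra 𝕜 (H →L[𝕜] H) where
  carrier := {T | ∀ L ∈ 𝓛, ∀ x ∈ L, T x ∈ L}
  mul_mem' := fun hS hT L hL x hx => hS L hL _ (hT L hL x hx)
  add_mem' := fun hS hT L hL x hx => L.toSubmodule.add_mem (hS L hL x hx) (hT L hL x hx)
  algebraMap_mem' := fun c L _ _ hx => L.toSubmodule.smul_mem c hx

/-- A subspace lattice is non-trivial if it is not `{{0}, H}`. -/
def IsNontrivial (𝓛 : SubspaceLattice 𝕜 H) : Prop :=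
  (𝓛 : Set (ClosedSubmodule 𝕜 H)) ≠ {⊥, ⊤}

variable [CompleteSpace H]

/-- A commutative subspace lattice (CSL): the orthogonal projections onto its members commute. -/
def IsCSL (𝓛 : SubspaceLattice 𝕜 H) : Prop :=
  ∀ L ∈ 𝓛, ∀ M ∈ 𝓛, Commute L.toSubmodule.starProjection M.toSubmodule.starProjection

theorem IsCSL.starProjection_mem {𝓛 : SubspaceLattice 𝕜 H} (h : 𝓛.IsCSL)
    {L : ClosedSubmodule 𝕜 H} (hL : L ∈ 𝓛) : L.toSubmodule.starProjection ∈ 𝓛.Alg := by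
  intro M hM x hx
  have hx' : M.toSubmodule.starProjection x = x :=
    Submodule.starProjection_eq_self_iff.mpr hx
  have hc : L.toSubmodule.starProjection (M.toSubmodule.starProjection x) =
      M.toSubmodule.starProjection (L.toSubmodule.starProjection x) :=
    DFunLike.congr_fun (h L hL M hM).eq x
  rw [hx'] at hc
  change L.toSubmodule.starProjection x ∈ M.toSubmodule
  rw [hc]
  exact Submodule.starProjection_apply_mem _ _

/-- The orthogonal projection onto a member `L` of a CSL `𝓛`, as an element of `Alg 𝓛`. -/
noncomputable def IsCSL.proj {𝓛 : SubspaceLattice 𝕜 H} (h : 𝓛.IsCSL)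
    {L : ClosedSubmodule 𝕜 H} (hL : L ∈ 𝓛) : 𝓛.Alg :=
  ⟨L.toSubmodule.starProjection, h.starProjection_mem hL⟩

end SubspaceLattice

/-!
Write `Q = 1 - P`. Since `L` is invariant, `Q A P = 0` for all `A`, so elements of `Alg 𝓛` are upper
triangular with respect to `P` and `Q`. Sufficiency of the decomposition is a computation with these
blocks (`IsLeftDerivableAt.of_decomposition`).

For necessity, the relation is tested on well-chosen pairs `A`, `B` with `A B + B A = P`. This gives
`δ P = 0`, `P δ 1 = 0`, that `δ` is right multiplication by `δ 1` on the corner `P · Q`, and that it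
maps the corner `Q · Q` to itself, with the remaining two conditions
(`IsLeftDerivableAt.decomposition`). What is left is that `δ` vanishes on the corner `P · P`. The
pairs `u P`, `u⁻¹ P / 2` with `u` invertible, together with Hua's identity, show that
`D A = δ (A P)` is a Jordan left derivation, `D (A²) = 2 A D A`
(`IsLeftDerivableAt.isJordanLeftDerivation`), and every continuous Jordan left derivation of `Alg 𝓛`
is zero (`SubspaceLattice.IsCSL.jordanLeftDerivation_eq_zero`), as follows.

* `D` vanishes on self-adjoint elements `s` commuting with the lattice. On a commutative algebra
  containing `s` and `(1 + s²)⁻¹` it is a derivation. If `c` and `t` are the real and imaginary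
  parts of the Cayley transform of `s`, then `c D t - t D c` is multiplied by `n` when the transform is
  replaced by its `n`-th power, yet stays bounded because the powers are unitary. So it is zero, and
  then so is `D s`. Skew-adjoint elements `k` follow from `0 = D (k²) = 2 k D k`.
* The off-diagonal corners `E A (1 - E)`, for `E` the projection onto a member of `𝓛`, annihilate
  every value of `D`. Let `p` be the projection onto their common kernel. It lies in `Alg 𝓛`, and
  `D A = p D A = D (p A p)`. By the choice of `p`, the element `p A p` commutes with the lattice, so
  this is zero.
-/

/-! ### Jordan left derivations of an algebra -/

/-- A Jordan left derivation of an algebra: a linear map `D` with `D (a²) = 2 a D a`. -/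
def IsJordanLeftDerivation {K R : Type*} [Field K] [Ring R] [Algebra K R] (D : R →ₗ[K] R) : Prop :=
  ∀ a, D (a * a) = (2 : K) • (a * D a)

namespace IsJordanLeftDerivation

variable {K R : Type*} [Field K] [Ring R] [Algebra K R] {D : R →ₗ[K] R}

theorem map_idempotent (hD : IsJordanLeftDerivation D) {e : R} (he : e * e = e) : D e = 0 := by
  have h := hD e
  rw [he] at h
  have h1 : e * D e = (2 : K) • (e * D e) := by
    conv_lhs => rw [h]
    rw [mul_smul_comm, ← mul_assoc, he]
  linear_combination (norm := module) h - (2 : K) • h1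

theorem map_mul_add_mul (hD : IsJordanLeftDerivation D) (a b : R) :
    D (a * b + b * a) = (2 : K) • (a * D b + b * D a) := by
  have h := hD (a + b)
  have h1 : (a + b) * (a + b) = a * a + (a * b + b * a) + b * b := by noncomm_ring
  rw [h1, map_add, map_add, hD a, hD b, map_add D a b] at h
  simp only [add_mul, mul_add] at h
  linear_combination (norm := module) h

variable [CharZero K]

theorem map_mul_of_commute (hD : IsJordanLeftDerivation D) {a b : R} (h : Commute a b) :
    D (a * b) = a * D b + b * D a := by
  have h1 := hD.map_mul_add_mul a b
  rw [← h.eq, map_add] at h1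
  linear_combination (norm := module) (1 / 2 : K) • h1

/-- A Jordan left derivation commutes with compressions to a corner, up to forgetting the right
factor: `D (e a e) = e D a`. -/
theorem map_corner (hD : IsJordanLeftDerivation D) {e : R} (he : e * e = e) (a : R) :
    D (e * a * e) = e * D a := by
  have he' (x : R) : e * (e * x) = e * x := by rw [← mul_assoc, he]
  have h0 := hD.map_idempotent he
  have h1 := hD.map_mul_add_mul e a
  have h2 := hD.map_mul_add_mul e (e * a + a * e)
  have h3 : e * (e * a + a * e) + (e * a + a * e) * e
      = (e * a + a * e) + (2 : K) • (e * a * e) := by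
    simp only [mul_add, add_mul, mul_assoc, he, he']
    module
  rw [h3, map_add, h1, h0, map_smul, mul_zero, mul_zero, add_zero, add_zero, mul_smul_comm,
    he'] at h2
  linear_combination (norm := module) (1 / 2 : K) • h2

/-- The off-diagonal corner of an invariant idempotent is killed: the two diagonal corners of `a`
already account for all of `D a`. -/
theorem map_off_diagonal (hD : IsJordanLeftDerivation D) {e : R} (he : e * e = e)
    (hinv : ∀ a, a * e = e * a * e) (a : R) : D (e * a * (1 - e)) = 0 := by
  have h1 := hD.map_corner he a
  have h2 := hD.map_corner (e := 1 - e) (by simp [mul_sub, sub_mul, he]) a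
  have h3 : a = e * a * e + (1 - e) * a * (1 - e) + e * a * (1 - e) := by
    simp only [mul_sub, sub_mul, mul_one, one_mul, ← hinv]
    abel
  have h4 : D a = e * D a + (1 - e) * D a + D (e * a * (1 - e)) := by
    conv_lhs => rw [h3]
    rw [map_add, map_add, h1, h2]
  rw [sub_mul, one_mul, add_sub_cancel] at h4
  exact left_eq_add.mp h4

/-- The values of `D` are annihilated by the off-diagonal corners of invariant idempotents, because
the Jordan product of `e a (1 - e)` with any `b` is again of the form `e x (1 - e)`. -/
theorem off_diagonal_mul_map (hD : IsJordanLeftDerivation D) {e : R} (he : e * e = e)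
    (hinv : ∀ a, a * e = e * a * e) (a b : R) : e * a * (1 - e) * D b = 0 := by
  have hb : e * (b * e) = b * e := by rw [hinv b, ← mul_assoc, ← mul_assoc, he]
  have hb' (x : R) : e * (b * (e * x)) = b * (e * x) := by
    rw [← mul_assoc b, ← mul_assoc, hb]
  have h := hD.map_mul_add_mul (e * a * (1 - e)) b
  have h1 : e * a * (1 - e) * b + b * (e * a * (1 - e))
      = e * (a * (1 - e) * b + b * e * a) * (1 - e) := by
    simp only [mul_sub, sub_mul, mul_add, add_mul, mul_one, mul_assoc, hb, hb']
    abel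
  rw [h1, hD.map_off_diagonal he hinv, hD.map_off_diagonal he hinv, mul_zero, add_zero] at h
  linear_combination (norm := module) (-1 / 2 : K) • h

/-- If `u⁻¹ D u + u D (u⁻¹) = 0` for every unit `u`, then `D` is a Jordan left derivation. Hua's
identity `u⁻¹ + (1 - u)⁻¹ = (u - u²)⁻¹` turns the condition on inverses into one on squares, when
`u` and `1 - u` are both units; a scalar shift reduces every element to that case. -/
theorem of_units (D : R →ₗ[K] R) (h : ∀ u : Rˣ, (u⁻¹ : Rˣ) * D u + u * D (u⁻¹ : Rˣ) = 0)
    (hR : ∀ a : R, ∃ k : K, IsUnit (a + algebraMap K R k) ∧ IsUnit (1 - (a + algebraMap K R k))) :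
    IsJordanLeftDerivation D := by
  have h1 : D 1 = 0 := by
    have := h 1
    simp only [inv_one, Units.val_one, one_mul] at this
    linear_combination (norm := module) (1 / 2 : K) • this
  have key (a : R) (ha : IsUnit a) (hb : IsUnit (1 - a)) : D (a * a) = (2 : K) • (a * D a) := by
    obtain ⟨u, rfl⟩ := ha
    obtain ⟨v, hv⟩ := hb
    have hvu : v * u = u * v := Units.ext <| by simp only [Units.val_mul, hv]; noncomm_ring
    have hdv : D v = - D u := by rw [hv, map_sub, h1, zero_sub]
    have hdw : D ((u * v : Rˣ) : R) = D u - D ((u : R) * u) := by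
      rw [Units.val_mul, hv, mul_sub, mul_one, map_sub]
    have hinv : ((u⁻¹ : Rˣ) : R) + (v⁻¹ : Rˣ) = ((u * v)⁻¹ : Rˣ) := by
      have e1 : (u : R) + v = 1 := by rw [hv]; abel
      have e2 : ((v⁻¹ : Rˣ) : R) * ((u : R) + v) * (u⁻¹ : Rˣ) = (v⁻¹ : Rˣ) * (u⁻¹ : Rˣ) := by
        rw [e1, mul_one]
      rw [mul_inv_rev, Units.val_mul, ← e2, mul_add, add_mul]
      simp [mul_assoc, add_comm]
    have hsq (w : Rˣ) : (w : R) * (w * D (w⁻¹ : Rˣ)) = - D w := by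
      have := congrArg ((w : R) * ·) (h w)
      simp only [mul_add, Units.mul_inv_cancel_left, mul_zero] at this
      exact eq_neg_of_add_eq_zero_right this
    -- with `v = 1 - u`, apply `D` to Hua's identity and multiply by `(u v)²`
    have hu := hsq u
    have hv' := hsq v
    have hw := hsq (u * v)
    rw [← hinv, map_add, hdw] at hw
    have hw1 (x : R) : ((u * v : Rˣ) : R) * (((u * v : Rˣ) : R) * x) = v * (v * (u * (u * x))) := by
      simp only [← Units.val_mul, ← mul_assoc]
      congr 2
      rw [← hvu, mul_assoc (v * u), ← hvu, ← mul_assoc, mul_assoc v u v, ← hvu, ← mul_assoc]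
    have hw2 (x : R) : ((u * v : Rˣ) : R) * (((u * v : Rˣ) : R) * x) = u * (u * (v * (v * x))) := by
      simp only [← Units.val_mul, ← mul_assoc]
      congr 2
      rw [mul_assoc u v u, hvu, ← mul_assoc]
    rw [mul_add, mul_add, hw1, hw2, hu, hv', hdv, hv] at hw
    simp only [mul_sub, sub_mul, mul_neg, neg_neg, one_mul] at hw
    linear_combination (norm := module) -hw
  intro a
  obtain ⟨k, hk1, hk2⟩ := hR a
  have h2 := key _ hk1 hk2
  have h3 : (a + algebraMap K R k) * (a + algebraMap K R k)
      = a * a + (2 * k) • a + (k * k) • (1 : R) := by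
    simp only [Algebra.algebraMap_eq_smul_one, mul_add, add_mul, smul_mul_assoc, mul_smul_comm,
      one_mul, mul_one]
    module
  have h4 : D (a + algebraMap K R k) = D a := by
    rw [Algebra.algebraMap_eq_smul_one, map_add, map_smul, h1, smul_zero, add_zero]
  rw [h3, h4, map_add, map_add, map_smul, map_smul, h1, smul_zero, add_zero, add_mul,
    Algebra.algebraMap_eq_smul_one, smul_mul_assoc, one_mul] at h2
  linear_combination (norm := module) h2

end IsJordanLeftDerivation

/-! ### Left derivability at an invariant idempotent -/

namespace IsIdempotentElem

variable {R : Type*} [Ring R] {P : R}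

theorem mul_mul_of_invariant (hP : IsIdempotentElem P) (hinv : ∀ a, a * P = P * a * P) (a : R) :
    P * (a * P) = a * P := by
  rw [hinv a, ← mul_assoc, ← mul_assoc, hP.eq]

theorem one_sub_mul_mul_of_invariant (hinv : ∀ a, a * P = P * a * P) (a : R) :
    (1 - P) * a * P = 0 := by
  rw [sub_mul, one_mul, sub_mul, ← hinv, sub_self]

theorem mul_eq_zero_of_invariant (hinv : ∀ a, a * P = P * a * P) {b : R} (hb : P * b = 0) :
    b * P = 0 := by
  rw [hinv, hb, zero_mul]

end IsIdempotentElem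

/-- A linear map `δ` is left derivable at `P` (in the Jordan sense) if `2 A δ(B) + 2 B δ(A) = δ(P)`
whenever `A B + B A = P`. -/
def IsLeftDerivableAt {K R : Type*} [Field K] [Ring R] [Algebra K R] (δ : R →ₗ[K] R) (P : R) :
    Prop :=
  ∀ A B : R, A * B + B * A = P → 2 * A * δ B + 2 * B * δ A = δ P

namespace IsLeftDerivableAt

open IsIdempotentElem

variable {K R : Type*} [Field K] [Ring R] [Algebra K R] {δ : R →ₗ[K] R} {P : R}

/-- The algebraic form of the sufficiency of the decomposition. -/
theorem of_decomposition (hP : IsIdempotentElem P) (hinv : ∀ a, a * P = P * a * P) {β : R →ₗ[K] R}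
    (h1 : ∀ A, δ A = β A + P * A * (1 - P) * δ 1)
    (h2 : ∀ A, β A = (1 - P) * β ((1 - P) * A * (1 - P)) * (1 - P))
    (h3 : ∀ A B, (1 - P) * A * (1 - P) * B * (1 - P) + (1 - P) * B * (1 - P) * A * (1 - P) = 0 →
        (1 - P) * A * β B + (1 - P) * B * β A = 0)
    (h4 : ∀ A B, P * A * (1 - P) * β B = P * A * (1 - P) * B * (1 - P) * δ 1) :
    IsLeftDerivableAt δ P := by
  have hQ : (1 - P) * (1 - P) = 1 - P := hP.one_sub.eq
  have hPQ : P * (1 - P) = 0 := by rw [mul_sub, mul_one, hP.eq, sub_self]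
  have hQP : (1 - P) * P = 0 := by rw [sub_mul, one_mul, hP.eq, sub_self]
  have hQβ (a : R) : (1 - P) * β a = β a := by
    rw [h2 a, ← mul_assoc, ← mul_assoc, hQ]
  have hQa (a : R) : (1 - P) * a * (1 - P) = (1 - P) * a := by
    rw [mul_sub (_ * a), mul_one, one_sub_mul_mul_of_invariant hinv, sub_zero]
  have hδP : δ P = 0 := by
    rw [h1, h2, mul_assoc (1 - P) P, hPQ, mul_zero, map_zero, mul_assoc P P, hPQ]
    simp
  intro A B hAB
  have hQAB : (1 - P) * A * β B + (1 - P) * B * β A = 0 := h3 A B <| by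
    rw [hQa, hQa, mul_assoc (1 - P), mul_assoc (1 - P) B, ← add_mul, ← mul_add, hAB, hQP, zero_mul]
  have e (A B : R) : A * δ B = (1 - P) * A * β B + P * (A * B) * (1 - P) * δ 1 := by
    have e1 : P * A * β B = P * A * (1 - P) * B * (1 - P) * δ 1 := by
      rw [← h4, mul_assoc (P * A) (1 - P), hQβ]
    have e2 : A * (P * B * (1 - P) * δ 1) = P * A * P * B * (1 - P) * δ 1 := by
      rw [← hinv]; simp only [mul_assoc]
    have e3 : A * β B = (1 - P) * A * β B + P * A * β B := by noncomm_ring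
    have e4 : P * (A * B) * (1 - P) * δ 1
        = P * A * (1 - P) * B * (1 - P) * δ 1 + P * A * P * B * (1 - P) * δ 1 := by noncomm_ring
    rw [h1 B, mul_add, e2, e3, e1, e4, add_assoc]
  rw [mul_assoc, mul_assoc, hδP, e A B, e B A, ← mul_add]
  have : P * (A * B) * (1 - P) * δ 1 + P * (B * A) * (1 - P) * δ 1 = 0 := by
    rw [← add_mul, ← add_mul, ← mul_add, hAB, hP.eq, hPQ, zero_mul]
  rw [add_add_add_comm, hQAB, this, add_zero, mul_zero]

variable [CharZero K]

theorem map_self (h : IsLeftDerivableAt δ P) (hP : IsIdempotentElem P) : δ P = 0 := by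
  have h1 := h P ((1 / 2 : K) • P) (by rw [mul_smul_comm, smul_mul_assoc, hP.eq]; module)
  rw [map_smul, two_mul, two_mul] at h1
  simp only [add_mul, mul_smul_comm, smul_mul_assoc] at h1
  have h2 := congrArg (P * ·) h1
  simp only [mul_add, mul_smul_comm, ← mul_assoc, hP.eq] at h2
  linear_combination (norm := module) (2 : K) • h2 - h1

theorem mul_map_add_mul_map (h : IsLeftDerivableAt δ P) (hP : IsIdempotentElem P) {A B : R}
    (hAB : A * B + B * A = P) : A * δ B + B * δ A = 0 := by
  have h1 := h A B hAB
  rw [h.map_self hP, two_mul, two_mul] at h1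
  simp only [add_mul] at h1
  linear_combination (norm := module) (1 / 2 : K) • h1

theorem mul_map_one (h : IsLeftDerivableAt δ P) (hP : IsIdempotentElem P) : P * δ 1 = 0 := by
  have h1 := h.mul_map_add_mul_map hP (A := P) (B := (1 / 2 : K) • 1)
    (by rw [mul_smul_comm, smul_mul_assoc, one_mul, mul_one]; module)
  rw [h.map_self hP, mul_zero, map_smul, mul_smul_comm] at h1
  linear_combination (norm := module) (2 : K) • h1

theorem mul_map_eq_zero (h : IsLeftDerivableAt δ P) (hP : IsIdempotentElem P)
    (hinv : ∀ a, a * P = P * a * P) {b : R} (hb : P * b = 0) : P * δ b = 0 := by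
  have hb' := mul_eq_zero_of_invariant hinv hb
  have h1 := h.mul_map_add_mul_map hP (A := P) (B := (1 / 2 : K) • P + b) (by
    rw [mul_add, add_mul, mul_smul_comm, smul_mul_assoc, hP.eq, hb, hb']; module)
  rwa [map_add, map_smul, h.map_self hP, smul_zero, zero_add, mul_zero, add_zero] at h1

/-- On the corner of `1 - P` the map `δ` is left derivable at `0`: compare `P + a` with
`P / 2 + b`. -/
theorem mul_map_add_mul_map_of_mul_eq_zero (h : IsLeftDerivableAt δ P) (hP : IsIdempotentElem P)
    (hinv : ∀ a, a * P = P * a * P) {a b : R} (ha : P * a = 0) (hb : P * b = 0)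
    (hab : a * b + b * a = 0) : a * δ b + b * δ a = 0 := by
  have ha' := mul_eq_zero_of_invariant hinv ha
  have hb' := mul_eq_zero_of_invariant hinv hb
  have h1 := h.mul_map_add_mul_map hP (A := P + a) (B := (1 / 2 : K) • P + b) (by
    simp only [mul_add, add_mul, mul_smul_comm, smul_mul_assoc, hP.eq, ha, ha', hb, hb']
    linear_combination (norm := module) hab)
  rwa [map_add, map_add, map_smul, h.map_self hP, smul_zero, zero_add, zero_add, add_mul, add_mul,
    h.mul_map_eq_zero hP hinv hb, smul_mul_assoc, h.mul_map_eq_zero hP hinv ha, smul_zero,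
    zero_add, zero_add] at h1

/-- On the off-diagonal corner of `P` the map `δ` is right multiplication by `δ 1`: compare `P + m`
with `P - 1 / 2`. -/
theorem map_off_diagonal (h : IsLeftDerivableAt δ P) (hP : IsIdempotentElem P) {m : R}
    (hm : P * m = m) (hm' : m * P = 0) : δ m = m * δ 1 := by
  have h1 := h.mul_map_add_mul_map hP (A := P + m) (B := P - (1 / 2 : K) • 1) (by
    simp only [mul_add, add_mul, mul_sub, sub_mul, mul_smul_comm, smul_mul_assoc, hP.eq, hm, hm',
      mul_one, one_mul]
    module)
  simp only [map_add, map_sub, map_smul, h.map_self hP, zero_sub, zero_add, mul_neg, add_mul,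
    sub_mul, mul_smul_comm, smul_mul_assoc, h.mul_map_one hP, one_mul] at h1
  have h2 := congrArg (P * ·) h1
  simp only [mul_add, mul_sub, mul_neg, mul_smul_comm, mul_zero, ← mul_assoc, hP.eq, hm] at h2
  linear_combination (norm := module) (4 : K) • h2 - (2 : K) • h1

/-- The action of the off-diagonal corner on `δ b`, for `b` in the corner of `1 - P`: compare
`P + m` with `P / 2 - m / 2 - m b + b`, the off-diagonal part being chosen so as to cancel `m b`. -/
theorem off_diagonal_mul_map (h : IsLeftDerivableAt δ P) (hP : IsIdempotentElem P)
    (hinv : ∀ a, a * P = P * a * P) {m b : R} (hm : P * m = m) (hm' : m * P = 0) (hb : P * b = 0) :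
    m * δ b = m * b * δ 1 := by
  have hb' := mul_eq_zero_of_invariant hinv hb
  have hmb : P * (m * b) = m * b := by rw [← mul_assoc, hm]
  have hmb' : m * b * P = 0 := by rw [mul_assoc, hb', mul_zero]
  have hmm : m * m = 0 := by rw [← hm, ← mul_assoc, mul_assoc P, hm', mul_zero, zero_mul]
  have hbm : b * m = 0 := by rw [← hm, ← mul_assoc, hb', zero_mul]
  have hmbm : m * b * m = 0 := by rw [mul_assoc, hbm, mul_zero]
  have hmmb : m * (m * b) = 0 := by rw [← mul_assoc, hmm, zero_mul]
  have h1 := h.mul_map_add_mul_map hP (A := P + m)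
    (B := (1 / 2 : K) • P - (1 / 2 : K) • m - m * b + b) (by
    simp only [mul_add, add_mul, mul_sub, sub_mul, mul_smul_comm, smul_mul_assoc, hP.eq, hm, hm',
      hb, hb', hmb, hmb', hmm, hbm, hmbm, hmmb]
    module)
  have hz : m * (m * δ 1) = 0 := by rw [← mul_assoc, hmm, zero_mul]
  have hz1 : m * (m * b * δ 1) = 0 := by rw [← mul_assoc, hmmb, zero_mul]
  have hz2 : m * b * (m * δ 1) = 0 := by rw [← mul_assoc, hmbm, zero_mul]
  have hz3 : b * (m * δ 1) = 0 := by rw [← mul_assoc, hbm, zero_mul]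
  have hz4 : P * (m * δ 1) = m * δ 1 := by rw [← mul_assoc, hm]
  have hz5 : P * (m * b * δ 1) = m * b * δ 1 := by rw [← mul_assoc, hmb]
  simp only [map_add, map_sub, map_smul, h.map_self hP, h.map_off_diagonal hP hm hm',
    h.map_off_diagonal hP hmb hmb', add_mul, sub_mul, mul_add, mul_sub, mul_smul_comm,
    smul_mul_assoc, h.mul_map_eq_zero hP hinv hb, hz, hz1, hz2, hz3, hz4, hz5, smul_zero, mul_zero]
    at h1
  linear_combination (norm := module) h1

/-- On the corner of `P`, extended to the whole algebra by `a ↦ a P`, the map `δ` is a Jordan left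
derivation. Compare `u P` with `u⁻¹ P / 2` for units `u`. -/
theorem isJordanLeftDerivation (h : IsLeftDerivableAt δ P) (hP : IsIdempotentElem P)
    (hinv : ∀ a, a * P = P * a * P)
    (hR : ∀ a : R, ∃ k : K, IsUnit (a + algebraMap K R k) ∧ IsUnit (1 - (a + algebraMap K R k))) :
    IsJordanLeftDerivation (δ ∘ₗ LinearMap.mulRight K P) := by
  refine .of_units _ (fun u => ?_) hR
  simp only [LinearMap.comp_apply, LinearMap.mulRight_apply]
  have e (u : Rˣ) : (u : R) * P * ((u⁻¹ : Rˣ) * P) = P := by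
    rw [mul_assoc, hP.mul_mul_of_invariant hinv, Units.mul_inv_cancel_left]
  have e' (u : Rˣ) : ((u⁻¹ : Rˣ) : R) * P * (u * P) = P := by
    rw [mul_assoc, hP.mul_mul_of_invariant hinv, Units.inv_mul_cancel_left]
  have h1 (u : Rˣ) := h.mul_map_add_mul_map hP (A := u * P) (B := (1 / 2 : K) • ((u⁻¹ : Rˣ) * P))
    (by rw [mul_smul_comm, smul_mul_assoc, e, e']; module)
  -- adding `1 - P` to `u P` does not change the Jordan product with `u⁻¹ P`
  have hQ (u : Rˣ) : (1 - P) * δ (u * P) = 0 := by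
    have h2 := h.mul_map_add_mul_map hP (A := (u⁻¹ : Rˣ) * P + (1 - P)) (B := (1 / 2 : K) • (u * P))
      (by
        have z := one_sub_mul_mul_of_invariant hinv (u : R)
        have z' : (u : R) * P * (1 - P) = 0 := by rw [mul_sub, mul_one, mul_assoc, hP.eq, sub_self]
        rw [mul_smul_comm, smul_mul_assoc, add_mul, mul_add, e, e', z', ← mul_assoc, z]; module)
    have h3 := h1 u⁻¹
    rw [inv_inv] at h3
    simp only [map_smul, map_add, map_sub, h.map_self hP, add_mul, mul_add, mul_smul_comm,
      smul_mul_assoc, sub_zero] at h2 h3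
    have h4 : (1 - P) * δ (u * P) + u * P * δ 1 = 0 := by
      linear_combination (norm := module) (2 : K) • h2 - (2 : K) • h3
    rwa [mul_assoc, h.mul_map_one hP, mul_zero, add_zero] at h4
  have hPδ (u : Rˣ) : P * δ (u * P) = δ (u * P) := by
    have := hQ u
    rw [sub_mul, one_mul, sub_eq_zero] at this
    exact this.symm
  have h2 := h1 u
  rw [smul_mul_assoc, map_smul, mul_smul_comm, mul_assoc, mul_assoc, hPδ, hPδ] at h2
  linear_combination (norm := module) (2 : K) • h2

/-- The algebraic form of the necessity of the decomposition, for a map that vanishes on the corner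
of `P`. There `β` has to be the restriction of `δ` to the corner of `1 - P`. -/
theorem decomposition (h : IsLeftDerivableAt δ P) (hP : IsIdempotentElem P)
    (hinv : ∀ a, a * P = P * a * P) (h0 : ∀ a, δ (a * P) = 0) {β : R → R}
    (hβ : ∀ a, β a = δ ((1 - P) * a * (1 - P))) :
    (∀ A, δ A = β A + P * A * (1 - P) * δ 1) ∧
      (∀ A, β A = (1 - P) * β ((1 - P) * A * (1 - P)) * (1 - P)) ∧
      (∀ A B, (1 - P) * A * (1 - P) * B * (1 - P) + (1 - P) * B * (1 - P) * A * (1 - P) = 0 →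
        (1 - P) * A * β B + (1 - P) * B * β A = 0) ∧
      (∀ A B, P * A * (1 - P) * β B = P * A * (1 - P) * B * (1 - P) * δ 1) := by
  have hQ : (1 - P) * (1 - P) = 1 - P := hP.one_sub.eq
  have hPQ : P * (1 - P) = 0 := by rw [mul_sub, mul_one, hP.eq, sub_self]
  have hQP : (1 - P) * P = 0 := by rw [sub_mul, one_mul, hP.eq, sub_self]
  have hc (a : R) : P * ((1 - P) * a * (1 - P)) = 0 := by
    rw [← mul_assoc, ← mul_assoc, hPQ, zero_mul, zero_mul]
  have hPβ (a : R) : P * β a = 0 := by rw [hβ]; exact h.mul_map_eq_zero hP hinv (hc a)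
  have hQβ (a : R) : (1 - P) * β a = β a := by rw [sub_mul, one_mul, hPβ, sub_zero]
  have hβQ (a : R) : β a * (1 - P) = β a := by
    rw [mul_sub, mul_one, mul_eq_zero_of_invariant hinv (hPβ a), sub_zero]
  have hm (a : R) : P * (P * a * (1 - P)) = P * a * (1 - P) := by
    rw [← mul_assoc, ← mul_assoc, hP.eq]
  have hm' (a : R) : P * a * (1 - P) * P = 0 := by rw [mul_assoc, hQP, mul_zero]
  have hββ (a : R) : β ((1 - P) * a * (1 - P)) = β a := by
    rw [hβ, hβ, ← mul_assoc, ← mul_assoc, hQ, mul_assoc, hQ]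
  refine ⟨fun A => ?_, fun A => ?_, fun A B hAB => ?_, fun A B => ?_⟩
  · have hA : A = A * P + P * A * (1 - P) + (1 - P) * A * (1 - P) := by noncomm_ring
    rw [hβ, ← h.map_off_diagonal hP (hm A) (hm' A)]
    conv_lhs => rw [hA]
    rw [map_add, map_add, h0, zero_add, add_comm]
  · rw [hββ, hQβ, hβQ]
  · have h1 := h.mul_map_add_mul_map_of_mul_eq_zero hP hinv (hc A) (hc B) (by
      rw [← hAB]
      simp only [mul_assoc]
      simp only [← mul_assoc (1 - P) (1 - P), hQ])
    rwa [← hβ, ← hβ, mul_assoc _ _ (β B), mul_assoc _ _ (β A), hQβ, hQβ] at h1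
  · have h1 := h.off_diagonal_mul_map hP hinv (hm A) (hm' A) (hc B)
    rw [hβ, h1]
    simp only [mul_assoc]
    simp only [← mul_assoc (1 - P) (1 - P), hQ]

end IsLeftDerivableAt

/-! ### Rotations and derivations of a commutative ring -/

namespace Derivation

variable {K S M : Type*} [Field K] [CommRing S] [Algebra K S] [AddCommGroup M] [Module S M]
  [Module K M]

/-- The `n`-th power of `c + i s`, as the pair of its real and imaginary parts, in a commutative
ring that need not contain `i`. -/
def rotation {S : Type*} [CommRing S] (c s : S) : ℕ → S × S
  | 0 => (1, 0)
  | n + 1 => (c * (rotation c s n).1 - s * (rotation c s n).2,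
      s * (rotation c s n).1 + c * (rotation c s n).2)

theorem rotation_sq_add_sq {S : Type*} [CommRing S] {c s : S} (h : c * c + s * s = 1) (n : ℕ) :
    (rotation c s n).1 * (rotation c s n).1 + (rotation c s n).2 * (rotation c s n).2 = 1 := by
  induction n with
  | zero => simp [rotation]
  | succ n ih =>
    simp only [rotation]
    linear_combination (c * c + s * s) * ih + h

/-- For `c = cos θ` and `s = sin θ` this reads `D (n θ) = n D θ`. -/
theorem rotation_smul_sub_smul (D : Derivation K S M) {c s : S} (h : c * c + s * s = 1) (n : ℕ) :
    (rotation c s n).1 • D (rotation c s n).2 - (rotation c s n).2 • D (rotation c s n).1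
      = (n : S) • (c • D s - s • D c) := by
  induction n with
  | zero => simp [rotation]
  | succ n ih =>
    have h1 := rotation_sq_add_sq h n
    simp only [rotation]
    generalize (rotation c s n).1 = x at *
    generalize (rotation c s n).2 = y at *
    simp only [map_add, map_sub, leibniz, Nat.cast_succ]
    linear_combination (norm := module) ih + h • (x • D y - y • D x) + h1 • (c • D s - s • D c)

variable [CharZero K]

theorem map_eq_zero_of_sq_add_sq (D : Derivation K S M) {c s : S} (h : c * c + s * s = 1)
    (hw : c • D s - s • D c = 0) : D c = 0 ∧ D s = 0 := by
  have h1 : c • D c + s • D s = 0 := by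
    have := congrArg D h
    simp only [map_add, leibniz, map_one_eq_zero] at this
    rw [← add_smul] at this
    have h2 : (2 : K) • (c • D c + s • D s) = 0 := by
      rw [two_smul, ← this]; module
    exact (smul_eq_zero.mp h2).resolve_left two_ne_zero
  constructor
  · linear_combination (norm := module) c • h1 - s • hw - h • D c
  · linear_combination (norm := module) s • h1 + c • hw - h • D s

/-- The real and imaginary parts of the Cayley transform of `s`, with `r = (1 + s²)⁻¹`, lie on the
unit circle. -/
theorem cayley_sq_add_sq {S : Type*} [CommRing S] {s r : S} (hr : (1 + s * s) * r = 1) :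
    ((1 - s * s) * r) * ((1 - s * s) * r) + (s * r + s * r) * (s * r + s * r) = 1 := by
  linear_combination ((1 + s * s) * r + 1) * hr

/-- A derivation that kills the angle of the Cayley transform of `s` kills `s`. -/
theorem map_eq_zero_of_cayley (D : Derivation K S M) {s r : S} (hr : (1 + s * s) * r = 1)
    (hw : ((1 - s * s) * r) • D (s * r + s * r) - (s * r + s * r) • D ((1 - s * s) * r) = 0) :
    D s = 0 := by
  obtain ⟨hc, hs⟩ := D.map_eq_zero_of_sq_add_sq (cayley_sq_add_sq hr) hw
  have e1 : (1 - s * s) * r = 2 * r - 1 := by linear_combination -hr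
  rw [e1, two_mul, map_sub, map_one_eq_zero, sub_zero, map_add, ← two_smul K] at hc
  rw [map_add, ← two_smul K] at hs
  have hr0 := (smul_eq_zero.mp hc).resolve_left two_ne_zero
  have hs0 := (smul_eq_zero.mp hs).resolve_left two_ne_zero
  rw [leibniz, hr0, smul_zero, zero_add] at hs0
  linear_combination (norm := module) (1 + s * s) • hs0 - hr • D s

/-- A derivation that stays bounded along the powers of the Cayley transform of `s` kills `s`, since
along the `n`-th power the angle is multiplied by `n`. -/
theorem map_eq_zero_of_norm_rotation_le {𝕜 S M : Type*} [RCLike 𝕜] [CommRing S] [Algebra 𝕜 S]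
    [NormedAddCommGroup M] [NormedSpace 𝕜 M] [Module S M] (D : Derivation 𝕜 S M) {s r : S}
    (hr : (1 + s * s) * r = 1) {C : ℝ}
    (hC : ∀ n, ‖(rotation ((1 - s * s) * r) (s * r + s * r) n).1 •
          D (rotation ((1 - s * s) * r) (s * r + s * r) n).2 -
        (rotation ((1 - s * s) * r) (s * r + s * r) n).2 •
          D (rotation ((1 - s * s) * r) (s * r + s * r) n).1‖ ≤ C) : D s = 0 := by
  refine D.map_eq_zero_of_cayley hr ?_
  have hsq := cayley_sq_add_sq hr
  generalize (1 - s * s) * r = c at *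
  generalize s * r + s * r = t at *
  by_contra hw
  obtain ⟨n, hn⟩ := exists_nat_gt (C / ‖c • D t - t • D c‖)
  rw [div_lt_iff₀ (norm_pos_iff.mpr hw)] at hn
  refine hn.not_ge ?_
  have h1 := hC n
  rwa [D.rotation_smul_sub_smul hsq, Nat.cast_smul_eq_nsmul, ← Nat.cast_smul_eq_nsmul 𝕜,
    norm_smul, RCLike.norm_natCast] at h1

end Derivation

/-! ### Operators and commuting elements -/

open scoped IsMulCommutative in
/-- Two commuting elements of an algebra lie in a commutative subalgebra, presented here as an
abstract algebra with an injective homomorphism. -/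
theorem exists_algHom_of_commute.{u, v} {K : Type u} {R : Type v} [Field K] [Ring R] [Algebra K R]
    {s r : R} (h : Commute s r) : ∃ (S : Type v) (_ : CommRing S) (_ : Algebra K S) (φ : S →ₐ[K] R)
      (s' r' : S), Function.Injective φ ∧ φ s' = s ∧ φ r' = r := by
  have hS : IsMulCommutative (Algebra.adjoin K {s, r}) := Algebra.isMulCommutative_adjoin K (by
    rintro x (rfl | rfl) y (rfl | rfl)
    exacts [rfl, h, h.symm, rfl])
  exact ⟨Algebra.adjoin K {s, r}, inferInstance, inferInstance, (Algebra.adjoin K {s, r}).val,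
    ⟨s, Algebra.subset_adjoin (Set.mem_insert _ _)⟩,
    ⟨r, Algebra.subset_adjoin (Set.mem_insert_of_mem _ rfl)⟩, Subtype.val_injective, rfl, rfl⟩

section Operator

variable {𝕜 H : Type*} [RCLike 𝕜] [NormedAddCommGroup H] [InnerProductSpace 𝕜 H] [CompleteSpace H]

open scoped InnerProductSpace

theorem re_inner_mul_self_of_isSelfAdjoint {T : H →L[𝕜] H} (hT : IsSelfAdjoint T) (x : H) :
    RCLike.re ⟪(T * T) x, x⟫_𝕜 = ‖T x‖ ^ 2 := by
  rw [mul_apply_eq_comp]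
  exact (congrArg RCLike.re (hT.isSymmetric (T x) x)).trans (inner_self_eq_norm_sq _)

theorem norm_le_one_of_sq_add_sq {S T : H →L[𝕜] H} (hS : IsSelfAdjoint S) (hT : IsSelfAdjoint T)
    (h : S * S + T * T = 1) : ‖S‖ ≤ 1 := by
  refine S.opNorm_le_bound zero_le_one fun x => ?_
  rw [one_mul]
  have h1 : RCLike.re ⟪(S * S + T * T) x, x⟫_𝕜 = ‖S x‖ ^ 2 + ‖T x‖ ^ 2 := by
    rw [add_apply, inner_add_left, map_add, re_inner_mul_self_of_isSelfAdjoint hS,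
      re_inner_mul_self_of_isSelfAdjoint hT]
  rw [h, one_apply_eq_self, inner_self_eq_norm_sq] at h1
  exact le_of_sq_le_sq (by nlinarith [sq_nonneg ‖T x‖]) (norm_nonneg _)

theorem isUnit_one_add_mul_self {T : H →L[𝕜] H} (hT : IsSelfAdjoint T) : IsUnit (1 + T * T) := by
  refine ContinuousLinearMap.isUnit_of_forall_le_norm_inner_map _ (c := 1) one_pos fun x => ?_
  refine le_trans ?_ (RCLike.re_le_norm _)
  rw [add_apply, inner_add_left, map_add, re_inner_mul_self_of_isSelfAdjoint hT,
    one_apply_eq_self, inner_self_eq_norm_sq, NNReal.coe_one, mul_one]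
  exact le_add_of_nonneg_right (sq_nonneg _)

theorem commute_starProjection_of_invariant {T : H →L[𝕜] H} (hT : IsSelfAdjoint T)
    (K : Submodule 𝕜 H) [K.HasOrthogonalProjection] (h : ∀ x ∈ K, T x ∈ K) :
    Commute T K.starProjection := by
  ext x
  refine (Submodule.eq_starProjection_of_mem_orthogonal (h _ (K.starProjection_apply_mem x))
    ?_).symm
  change T x - T (K.starProjection x) ∈ Kᗮ
  rw [← map_sub, Submodule.mem_orthogonal]
  intro u hu
  refine (hT.isSymmetric u _).symm.trans ?_
  exact Submodule.inner_right_of_mem_orthogonal (h u hu) (K.sub_starProjection_mem_orthogonal x)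

end Operator

/-! ### Jordan left derivations on the diagonal of the algebra of a subspace lattice -/

namespace SubspaceLattice

variable {𝕜 H : Type*} [RCLike 𝕜] [NormedAddCommGroup H] [InnerProductSpace 𝕜 H]

theorem isClosed_Alg (𝓛 : SubspaceLattice 𝕜 H) : IsClosed (𝓛.Alg : Set (H →L[𝕜] H)) := by
  have : (𝓛.Alg : Set (H →L[𝕜] H)) = ⋂ L ∈ 𝓛, ⋂ x ∈ L, {T : H →L[𝕜] H | T x ∈ L} := by
    ext T
    simp only [Set.mem_iInter]
    rfl
  rw [this]
  refine isClosed_biInter fun L _ => isClosed_biInter fun x _ => ?_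
  exact L.isClosed.preimage (ContinuousLinearMap.apply 𝕜 H x).continuous

variable [CompleteSpace H]

instance (𝓛 : SubspaceLattice 𝕜 H) : CompleteSpace 𝓛.Alg :=
  𝓛.isClosed_Alg.completeSpace_coe

/-- Every element of `Alg 𝓛` has a scalar translate `b` with `b` and `1 - b` invertible. -/
theorem exists_isUnit_add (𝓛 : SubspaceLattice 𝕜 H) (a : 𝓛.Alg) :
    ∃ k : 𝕜, IsUnit (a + algebraMap 𝕜 𝓛.Alg k) ∧ IsUnit (1 - (a + algebraMap 𝕜 𝓛.Alg k)) := by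
  obtain ⟨n, hn⟩ := exists_nat_gt (‖a‖ * ‖(1 : 𝓛.Alg)‖)
  have h1 : ((n : 𝕜) + 1) ∈ resolventSet 𝕜 (-a) := by
    apply spectrum.mem_resolventSet_of_norm_lt_mul
    rw [norm_neg, ← Nat.cast_succ, RCLike.norm_natCast]
    push_cast
    exact hn.trans (lt_add_one _)
  have h2 : (-(n : 𝕜)) ∈ resolventSet 𝕜 a := by
    apply spectrum.mem_resolventSet_of_norm_lt_mul
    rwa [norm_neg, RCLike.norm_natCast]
  refine ⟨n + 1, ?_, ?_⟩
  · have := spectrum.mem_resolventSet_iff.mp h1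
    rwa [sub_neg_eq_add, add_comm] at this
  · have := spectrum.mem_resolventSet_iff.mp h2
    convert this using 1
    rw [map_add, map_neg, map_one]
    abel

theorem mem_Alg_of_commute {𝓛 : SubspaceLattice 𝕜 H} {T : H →L[𝕜] H}
    (h : ∀ M ∈ 𝓛, Commute T M.toSubmodule.starProjection) : T ∈ 𝓛.Alg := by
  intro M hM x hx
  have h1 : M.toSubmodule.starProjection x = x := Submodule.starProjection_eq_self_iff.mpr hx
  have h2 := DFunLike.congr_fun (h M hM).eq x
  rw [mul_apply_eq_comp, mul_apply_eq_comp, h1] at h2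
  exact Submodule.starProjection_eq_self_iff.mp h2.symm

theorem norm_mul_map_sub_mul_map_le {𝓛 : SubspaceLattice 𝕜 H} (D : 𝓛.Alg →L[𝕜] 𝓛.Alg)
    {x y : 𝓛.Alg} (hx : IsSelfAdjoint (x : H →L[𝕜] H)) (hy : IsSelfAdjoint (y : H →L[𝕜] H))
    (hxy : (x : H →L[𝕜] H) * x + (y : H →L[𝕜] H) * y = 1) :
    ‖x * D y - y * D x‖ ≤ 2 * ‖D‖ := by
  have hx1 : ‖x‖ ≤ 1 := norm_le_one_of_sq_add_sq hx hy hxy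
  have hy1 : ‖y‖ ≤ 1 := norm_le_one_of_sq_add_sq hy hx (by rwa [add_comm])
  have key (x y : 𝓛.Alg) (hx : ‖x‖ ≤ 1) (hy : ‖y‖ ≤ 1) : ‖x * D y‖ ≤ ‖D‖ :=
    calc ‖x * D y‖ ≤ ‖x‖ * ‖D y‖ := norm_mul_le _ _
      _ ≤ 1 * ‖D‖ := by
        gcongr
        exact (D.le_opNorm y).trans (mul_le_of_le_one_right (norm_nonneg _) hy)
      _ = ‖D‖ := one_mul _
  rw [two_mul]
  exact (norm_sub_le _ _).trans (add_le_add (key x y hx1 hy1) (key y x hy1 hx1))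

/-- The Cayley transform of a self-adjoint element is unitary, so its powers, and hence the values
of `D` on them, are bounded. The element and its `r = (1 + s²)⁻¹` are taken in a commutative algebra
`S` over `Alg 𝓛`, on which `D` is a derivation. Splitting the powers into real and imaginary parts
covers real scalars as well. -/
theorem map_eq_zero_of_algHom {𝓛 : SubspaceLattice 𝕜 H} {D : 𝓛.Alg →L[𝕜] 𝓛.Alg}
    (hD : IsJordanLeftDerivation (D : 𝓛.Alg →ₗ[𝕜] 𝓛.Alg)) {S : Type*} [CommRing S] [Algebra 𝕜 S]
    (φ : S →ₐ[𝕜] 𝓛.Alg) {s r : S} (hr : (1 + s * s) * r = 1)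
    (hs : IsSelfAdjoint (φ s : H →L[𝕜] H)) (hrsa : IsSelfAdjoint (φ r : H →L[𝕜] H)) :
    D (φ s) = 0 := by
  let : Module S 𝓛.Alg := Module.compHom _ φ.toRingHom
  let d : Derivation 𝕜 S 𝓛.Alg := Derivation.mk' ((D : 𝓛.Alg →ₗ[𝕜] 𝓛.Alg) ∘ₗ φ.toLinearMap)
    fun a b => by
      have hab : Commute (φ a) (φ b) := (Commute.all a b).map φ
      refine (congrArg D (map_mul φ a b)).trans (hD.map_mul_of_commute hab)
  -- self-adjointness is tested in the operators on `H`: `Alg 𝓛` is not closed under adjoints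
  let sa (x : S) : Prop := IsSelfAdjoint (φ x : H →L[𝕜] H)
  have sa_mul {x y : S} (hx : sa x) (hy : sa y) : sa (x * y) := by
    have hxy : Commute (φ x : H →L[𝕜] H) (φ y) :=
      congrArg Subtype.val ((Commute.all x y).map φ).eq
    have := (IsSelfAdjoint.commute_iff hx hy).mp hxy
    simp only [sa, map_mul]
    exact this
  have sa_one : sa 1 := by simp only [sa, map_one]; exact IsSelfAdjoint.one _
  have sa_zero : sa 0 := by simp only [sa, map_zero]; exact IsSelfAdjoint.zero _
  have sa_add {x y : S} (hx : sa x) (hy : sa y) : sa (x + y) := by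
    simp only [sa, map_add]; exact IsSelfAdjoint.add hx hy
  have sa_sub {x y : S} (hx : sa x) (hy : sa y) : sa (x - y) := by
    simp only [sa, map_sub]; exact IsSelfAdjoint.sub hx hy
  have hsq := Derivation.cayley_sq_add_sq hr
  have hrot (n : ℕ) : sa (Derivation.rotation ((1 - s * s) * r) (s * r + s * r) n).1 ∧
      sa (Derivation.rotation ((1 - s * s) * r) (s * r + s * r) n).2 := by
    have hc := sa_mul (sa_sub sa_one (sa_mul hs hs)) hrsa
    have ht := sa_add (sa_mul hs hrsa) (sa_mul hs hrsa)
    induction n with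
    | zero => exact ⟨sa_one, sa_zero⟩
    | succ n ih =>
      exact ⟨sa_sub (sa_mul hc ih.1) (sa_mul ht ih.2), sa_add (sa_mul ht ih.1) (sa_mul hc ih.2)⟩
  refine d.map_eq_zero_of_norm_rotation_le hr (C := 2 * ‖D‖) fun n => ?_
  refine norm_mul_map_sub_mul_map_le D (hrot n).1 (hrot n).2 ?_
  have := congrArg φ (Derivation.rotation_sq_add_sq hsq n)
  rw [map_add, map_mul, map_mul, map_one] at this
  exact congrArg Subtype.val this

theorem map_eq_zero_of_isSelfAdjoint {𝓛 : SubspaceLattice 𝕜 H} {D : 𝓛.Alg →L[𝕜] 𝓛.Alg}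
    (hD : IsJordanLeftDerivation (D : 𝓛.Alg →ₗ[𝕜] 𝓛.Alg)) {s : 𝓛.Alg}
    (hs : IsSelfAdjoint (s : H →L[𝕜] H))
    (hc : ∀ M ∈ 𝓛, Commute (s : H →L[𝕜] H) M.toSubmodule.starProjection) : D s = 0 := by
  obtain ⟨u, hu⟩ := isUnit_one_add_mul_self hs
  have hrc (M) (hM : M ∈ 𝓛) : Commute ((u⁻¹ : (H →L[𝕜] H)ˣ) : H →L[𝕜] H)
      M.toSubmodule.starProjection := by
    refine Commute.units_inv_left ?_
    rw [hu]
    exact (Commute.one_left _).add_left ((hc M hM).mul_left (hc M hM))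
  have hrs : Commute (s : H →L[𝕜] H) ((u⁻¹ : (H →L[𝕜] H)ˣ) : H →L[𝕜] H) := by
    refine Commute.units_inv_right ?_
    rw [hu]
    exact (Commute.one_right _).add_right ((Commute.refl _).mul_right (Commute.refl _))
  have hrsa : IsSelfAdjoint ((u⁻¹ : (H →L[𝕜] H)ˣ) : H →L[𝕜] H) := by
    have husa : star (u : H →L[𝕜] H) = u := by
      rw [hu, star_add, star_one, star_mul, hs.star_eq]
    have h1 : star ((u⁻¹ : (H →L[𝕜] H)ˣ) : H →L[𝕜] H) * u = 1 := by
      rw [← husa, ← star_mul, u.mul_inv, star_one]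
    exact left_inv_eq_right_inv h1 u.mul_inv
  let r : 𝓛.Alg := ⟨_, mem_Alg_of_commute hrc⟩
  have hr : (1 + s * s) * r = 1 := Subtype.ext <| by
    change (1 + (s : H →L[𝕜] H) * s) * ((u⁻¹ : (H →L[𝕜] H)ˣ) : H →L[𝕜] H) = 1
    rw [← hu, u.mul_inv]
  have hcomm : s * r = r * s := Subtype.ext hrs.eq
  obtain ⟨S, _, _, φ, s', r', hφ, hs', hr'⟩ := exists_algHom_of_commute (K := 𝕜) hcomm
  rw [← hs']
  refine map_eq_zero_of_algHom hD φ (r := r') (hφ ?_) (by rwa [hs']) (by rwa [hr'])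
  rw [map_mul, map_add, map_mul, map_one, hs', hr', hr]

variable {𝓛 : SubspaceLattice 𝕜 H} {D : 𝓛.Alg →L[𝕜] 𝓛.Alg}

/-- For skew-adjoint `k` the square is self-adjoint, so `k D k = 0`. Compression to the kernel of
`k`, whose projection lies in `Alg 𝓛`, fixes `D k` and kills `k`. -/
theorem map_eq_zero_of_star_eq_neg (hD : IsJordanLeftDerivation (D : 𝓛.Alg →ₗ[𝕜] 𝓛.Alg))
    {k : 𝓛.Alg} (hk : star (k : H →L[𝕜] H) = -k)
    (hc : ∀ M ∈ 𝓛, Commute (k : H →L[𝕜] H) M.toSubmodule.starProjection) : D k = 0 := by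
  have hkk : D (k * k) = 0 := by
    refine map_eq_zero_of_isSelfAdjoint hD ?_ fun M hM => (hc M hM).mul_left (hc M hM)
    change star ((k : H →L[𝕜] H) * k) = k * k
    rw [star_mul, hk, neg_mul_neg]
  have hkD : k * D k = 0 := by
    have := hD k
    rw [ContinuousLinearMap.coe_coe, hkk] at this
    exact (smul_eq_zero.mp this.symm).resolve_left two_ne_zero
  let N : Submodule 𝕜 H := (k : H →L[𝕜] H).ker
  have : CompleteSpace N := (k : H →L[𝕜] H).isClosed_ker.completeSpace_coe
  have hq : N.starProjection ∈ 𝓛.Alg := mem_Alg_of_commute fun M hM => by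
    refine (commute_starProjection_of_invariant (isSelfAdjoint_starProjection _) N
      fun x hx => ?_).symm
    have h1 := DFunLike.congr_fun (hc M hM).eq x
    rw [mul_apply_eq_comp, mul_apply_eq_comp,
      show (k : H →L[𝕜] H) x = 0 from LinearMap.mem_ker.mp hx, map_zero] at h1
    exact h1
  let q : 𝓛.Alg := ⟨N.starProjection, hq⟩
  have hkq : k * q = 0 := Subtype.ext <| ContinuousLinearMap.ext fun x =>
    LinearMap.mem_ker.mp (N.starProjection_apply_mem x)
  have hqD : q * D k = D k := Subtype.ext <| ContinuousLinearMap.ext fun x =>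
    Submodule.starProjection_eq_self_iff.mpr <| LinearMap.mem_ker.mpr <|
      DFunLike.congr_fun (congrArg Subtype.val hkD) x
  have hqq : q * q = q := Subtype.ext N.isIdempotentElem_starProjection.eq
  have h1 := hD.map_corner hqq k
  rw [mul_assoc, hkq, mul_zero, map_zero] at h1
  exact hqD.symm.trans h1.symm

/-- A continuous Jordan left derivation vanishes on the diagonal, the commutant of the lattice. -/
theorem map_eq_zero_of_commute (hD : IsJordanLeftDerivation (D : 𝓛.Alg →ₗ[𝕜] 𝓛.Alg))
    {t : 𝓛.Alg} (hc : ∀ M ∈ 𝓛, Commute (t : H →L[𝕜] H) M.toSubmodule.starProjection) :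
    D t = 0 := by
  have hc' (M) (hM : M ∈ 𝓛) : Commute (star (t : H →L[𝕜] H)) M.toSubmodule.starProjection := by
    have := (hc M hM).star_star
    rwa [(isSelfAdjoint_starProjection M.toSubmodule).star_eq] at this
  let t' : 𝓛.Alg := ⟨star (t : H →L[𝕜] H), mem_Alg_of_commute hc'⟩
  have h1 : D (t + t') = 0 := by
    refine map_eq_zero_of_isSelfAdjoint hD ?_ fun M hM => (hc M hM).add_left (hc' M hM)
    exact IsSelfAdjoint.add_star_self (t : H →L[𝕜] H)
  have h2 : D (t - t') = 0 := by
    refine map_eq_zero_of_star_eq_neg hD ?_ fun M hM => (hc M hM).sub_left (hc' M hM)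
    change star ((t : H →L[𝕜] H) - star (t : H →L[𝕜] H)) = -(t - star (t : H →L[𝕜] H))
    rw [star_sub, star_star, neg_sub]
  rw [map_add] at h1
  rw [map_sub] at h2
  linear_combination (norm := module) (1 / 2 : 𝕜) • h1 + (1 / 2 : 𝕜) • h2

/-! ### Jordan left derivations on the algebra of a commutative subspace lattice -/

theorem IsCSL.proj_mul_self (hcsl : 𝓛.IsCSL) {L : ClosedSubmodule 𝕜 H} (hL : L ∈ 𝓛) :
    hcsl.proj hL * hcsl.proj hL = hcsl.proj hL :=
  Subtype.ext L.toSubmodule.isIdempotentElem_starProjection.eq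

theorem IsCSL.mul_proj (hcsl : 𝓛.IsCSL) {L : ClosedSubmodule 𝕜 H} (hL : L ∈ 𝓛) (a : 𝓛.Alg) :
    a * hcsl.proj hL = hcsl.proj hL * a * hcsl.proj hL :=
  Subtype.ext <| ContinuousLinearMap.ext fun x => (Submodule.starProjection_eq_self_iff.mpr
    (a.2 L hL _ (L.toSubmodule.starProjection_apply_mem x))).symm

/-- A continuous Jordan left derivation of the algebra of a commutative subspace lattice vanishes.
Its values are fixed by the projection `p` onto the common kernel of all off-diagonal corners, and
compressing by `p` lands in the diagonal. -/
theorem IsCSL.jordanLeftDerivation_eq_zero (hcsl : 𝓛.IsCSL)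
    (hD : IsJordanLeftDerivation (D : 𝓛.Alg →ₗ[𝕜] 𝓛.Alg)) : D = 0 := by
  let N : Submodule 𝕜 H := ⨅ (M : 𝓛) (a : 𝓛.Alg),
    ((hcsl.proj M.2 * a * (1 - hcsl.proj M.2) : 𝓛.Alg) : H →L[𝕜] H).ker
  have hN (x : H) : x ∈ N ↔ ∀ (M) (hM : M ∈ 𝓛) (a : 𝓛.Alg),
      ((hcsl.proj hM * a * (1 - hcsl.proj hM) : 𝓛.Alg) : H →L[𝕜] H) x = 0 := by
    simp only [N, Submodule.mem_iInf, LinearMap.mem_ker]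
    exact ⟨fun h M hM a => h ⟨M, hM⟩ a, fun h M a => h M M.2 a⟩
  have hNc : IsClosed (N : Set H) := by
    simp only [N, Submodule.coe_iInf]
    exact isClosed_iInter fun M => isClosed_iInter fun a => ContinuousLinearMap.isClosed_ker _
  have : CompleteSpace N := hNc.completeSpace_coe
  have hcomm {M M'} (hM : M ∈ 𝓛) (hM' : M' ∈ 𝓛) :
      hcsl.proj hM * hcsl.proj hM' = hcsl.proj hM' * hcsl.proj hM :=
    Subtype.ext (hcsl M hM M' hM').eq
  have hpc (M) (hM : M ∈ 𝓛) : Commute N.starProjection M.toSubmodule.starProjection := by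
    refine (commute_starProjection_of_invariant (isSelfAdjoint_starProjection _) N
      fun x hx => ?_).symm
    rw [hN] at hx ⊢
    intro M' hM' a
    have h1 : hcsl.proj hM' * a * (1 - hcsl.proj hM') * hcsl.proj hM
        = hcsl.proj hM' * (a * hcsl.proj hM) * (1 - hcsl.proj hM') := by
      simp only [mul_assoc, mul_sub, sub_mul, mul_one, hcomm hM hM']
    have h2 := hx M' hM' (a * hcsl.proj hM)
    rw [← h1] at h2
    exact h2
  let p : 𝓛.Alg := ⟨N.starProjection, mem_Alg_of_commute hpc⟩
  have hpp : p * p = p := Subtype.ext N.isIdempotentElem_starProjection.eq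
  have hep {M} (hM : M ∈ 𝓛) : p * hcsl.proj hM = hcsl.proj hM * p := Subtype.ext (hpc M hM).eq
  have hzero {M} (hM : M ∈ 𝓛) (a : 𝓛.Alg) : hcsl.proj hM * a * (1 - hcsl.proj hM) * p = 0 :=
    Subtype.ext <| ContinuousLinearMap.ext fun x =>
      (hN _).mp (N.starProjection_apply_mem x) M hM a
  ext1 a
  have hpD : p * D a = D a := Subtype.ext <| ContinuousLinearMap.ext fun x =>
    Submodule.starProjection_eq_self_iff.mpr <| (hN _).mpr fun M hM b =>
      DFunLike.congr_fun (congrArg Subtype.val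
        (hD.off_diagonal_mul_map (hcsl.proj_mul_self hM) (hcsl.mul_proj hM) b a)) x
  have hdiag : D (p * a * p) = 0 := by
    refine map_eq_zero_of_commute hD fun M hM => ?_
    have h1 : p * a * p * hcsl.proj hM = hcsl.proj hM * (p * a * p) := by
      have h2 := hzero hM (p * a)
      have h3 := hcsl.mul_proj hM (p * a * p)
      have h4 : hcsl.proj hM * (p * a) * (1 - hcsl.proj hM) * p
          = hcsl.proj hM * (p * a * p) - hcsl.proj hM * (p * a * p) * hcsl.proj hM := by
        simp only [mul_assoc, mul_sub, sub_mul, mul_one, hep]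
      rw [h4, sub_eq_zero] at h2
      rw [h3, ← h2]
    exact congrArg Subtype.val h1
  have h1 := hD.map_corner hpp a
  rw [ContinuousLinearMap.coe_coe, hdiag, hpD] at h1
  exact h1.symm

end SubspaceLattice

theorem corollary2p6 {𝕜 H : Type*} [RCLike 𝕜] [NormedAddCommGroup H] [InnerProductSpace 𝕜 H]
    [CompleteSpace H] (𝓛 : SubspaceLattice 𝕜 H) (hcsl : 𝓛.IsCSL) (hnt : 𝓛.IsNontrivial)
    (L : ClosedSubmodule 𝕜 H) (hL : L ∈ 𝓛) (hL0 : L ≠ ⊥) (hL1 : L ≠ ⊤)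
    (P : 𝓛.Alg) (hP : P = hcsl.proj hL) (δ : 𝓛.Alg →L[𝕜] 𝓛.Alg) :
    (∀ A B : 𝓛.Alg, A * B + B * A = P → 2 * A * δ B + 2 * B * δ A = δ P) ↔
      ∃ β : 𝓛.Alg →L[𝕜] 𝓛.Alg,
        (∀ A, δ A = β A + P * A * (1 - P) * δ 1) ∧
        (∀ A, β A = (1 - P) * β ((1 - P) * A * (1 - P)) * (1 - P)) ∧
        (∀ A B : 𝓛.Alg,
          (1 - P) * A * (1 - P) * B * (1 - P) + (1 - P) * B * (1 - P) * A * (1 - P) = 0 →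
            (1 - P) * A * β B + (1 - P) * B * β A = 0) ∧
        (∀ A B : 𝓛.Alg, P * A * (1 - P) * β B = P * A * (1 - P) * B * (1 - P) * δ 1) := by
  have hPi : IsIdempotentElem P := hP ▸ hcsl.proj_mul_self hL
  have hinv (a : 𝓛.Alg) : a * P = P * a * P := hP ▸ hcsl.mul_proj hL a
  constructor
  · intro h
    replace h : IsLeftDerivableAt (δ : 𝓛.Alg →ₗ[𝕜] 𝓛.Alg) P := h
    have hJ := h.isJordanLeftDerivation hPi hinv 𝓛.exists_isUnit_add
    have h0 : δ.comp ((ContinuousLinearMap.mul 𝕜 𝓛.Alg).flip P) = 0 :=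
      hcsl.jordanLeftDerivation_eq_zero hJ
    let β : 𝓛.Alg →L[𝕜] 𝓛.Alg := δ.comp
      (((ContinuousLinearMap.mul 𝕜 𝓛.Alg).flip (1 - P)).comp
        (ContinuousLinearMap.mul 𝕜 𝓛.Alg (1 - P)))
    exact ⟨β, h.decomposition hPi hinv (fun a => DFunLike.congr_fun h0 a) fun a => rfl⟩
  · rintro ⟨β, h1, h2, h3, h4⟩
    exact IsLeftDerivableAt.of_decomposition (δ := (δ : 𝓛.Alg →ₗ[𝕜] 𝓛.Alg))
      (β := (β : 𝓛.Alg →ₗ[𝕜] 𝓛.Alg)) hPi hinv h1 h2 h3 h4
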